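/- Let $k\le n$ be integers with $k\ge 1$, and let $G$ be a simple graph on the vertex set $\{1,\dots,n+1\}$ whose edges $e$ carry weights $w_e$ in a commutative ring (for example independent indeterminates). The vertices in $[k+1]=\{1,\dots,k+1\}$ are called marked. Let $L$ be the weighted Laplacian of $G$: $L_{uv}=-w_{uv}$ for $u\ne v$ (with $w_{uv}=0$ if $uv$ is not an edge) and $L_{uu}=\sum_{x\neq u}w_{ux}$. For a matrix $M$, let $M_{U,W}$ be $M$ with the rows indexed by $U$ and the columns indexed by $W$ removed, and write $M_{i,j}=M_{\{i\},\{j\}}$. A $t$-forest is a spanning forest of $G$ with exactly $t$ trees (isolated vertices count as trees). The weight of a forest is $w(F)=\prod_{e\in F}w_e$. A pair of forests is forbidden if two distinct marked vertices lie in the same tree in both forests of the pair. Fix distinct $c,j\in[k+1]$, put $j'=j$ if $j<c$ and $j'=j-1$ if $j>c$, and let $M=L_{c,c}$, so that $j'$ is the position of the column of the vertex $j$ in $M$. The $j'$-th column expansion identity for $M$, $$\det(M)\det(M_{[k],[k]})=\sum_{i=1}^k(-1)^{i+j'}\det(M_{i,j'})\det(M_{[k]\setminus\{i\},[k]\setminus\{j'\}}),$$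 holds and has the following combinatorial interpretation. 1. The left side equals $\sum w(T)\,w(F)$ over all pairs $(T,F)$ in which $T$ is a spanning tree of $G$ and $F$ is a $(k+1)$-forest with all the marked vertices in different trees. 2. The right side equals $\sum w(F_2)\,w(F_k)$, each pair taken exactly once and with positive sign, over all non-forbidden pairs $(F_2,F_k)$ in which $F_2$ is a $2$-forest with $c$ and $j$ in different trees, and $F_k$ is a $k$-forest in which the $k$ marked vertices other than $j$ lie in different trees (so $j$ shares its tree in $F_k$ with exactly one other marked vertex). -/

import Mathlib

/-- The set `[k]` of the first `k` indices of `Fin n`. -/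
def firstIdx {k n : ℕ} (h : k ≤ n) : Finset (Fin n) :=
  Finset.univ.map (Fin.castLEEmb h)

/-- `M_{U,W}`: the rows in `U` and the columns in `W` are removed, and the remaining rows and
columns keep their order. -/
def removeRowsCols {R : Type*} {n : ℕ} (M : Matrix (Fin n) (Fin n) R) (U W : Finset (Fin n))
    (h : W.card = U.card) : Matrix (Fin Uᶜ.card) (Fin Uᶜ.card) R :=
  M.submatrix (Uᶜ.orderEmbOfFin rfl)
    (Wᶜ.orderEmbOfFin (by rw [Finset.card_compl, Finset.card_compl, h]))

theorem card_erase_firstIdx {k n : ℕ} (h : k ≤ n) (i j : Fin k) :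
    ((firstIdx h).erase (Fin.castLE h j)).card = ((firstIdx h).erase (Fin.castLE h i)).card := by
  rw [Finset.card_erase_of_mem, Finset.card_erase_of_mem] <;> simp [firstIdx]

/-- `det(M) det(M_{[k],[k]})`. -/
def columnExpansionLeft {R : Type*} [CommRing R] {k n : ℕ} (h : k ≤ n)
    (M : Matrix (Fin n) (Fin n) R) : R :=
  M.det * (removeRowsCols M (firstIdx h) (firstIdx h) rfl).det

/-- `∑_{i ∈ [k]} (-1)^{i+j} det(M_{i,j}) det(M_{[k] \ {i}, [k] \ {j}})`. Indices start at `0`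
here, which does not change the parity of `i + j`. -/
def columnExpansionRight {R : Type*} [CommRing R] {k n : ℕ} (h : k ≤ n)
    (M : Matrix (Fin n) (Fin n) R) (j : Fin k) : R :=
  ∑ i : Fin k, (-1) ^ ((i : ℕ) + (j : ℕ)) *
    (removeRowsCols M {Fin.castLE h i} {Fin.castLE h j} rfl).det *
    (removeRowsCols M ((firstIdx h).erase (Fin.castLE h i)) ((firstIdx h).erase (Fin.castLE h j))
      (card_erase_firstIdx h i j)).det

open Classical in
/-- The weight of the (undirected) edge `uv` of `G`; it is `0` if `uv` is not an edge. -/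
noncomputable def edgeWeight {V R : Type*} [Zero R] (G : SimpleGraph V) (w : Sym2 V → R)
    (u v : V) : R :=
  if G.Adj u v then w s(u, v) else 0

/-- The weighted Laplacian of `G`: the entry at `(u, v)` is minus the weight of `uv` if `u ≠ v`,
and the sum of the weights of the edges at `u` if `u = v`. -/
noncomputable def weightedLaplacian {V R : Type*} [Fintype V] [DecidableEq V] [CommRing R]
    (G : SimpleGraph V) (w : Sym2 V → R) : Matrix V V R :=
  Matrix.of fun u v =>
    if u = v then ∑ x ∈ Finset.univ.erase u, edgeWeight G w u x else -edgeWeight G w u v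

/-- `F` is a spanning forest of `G` with exactly `r` trees (isolated vertices count as trees).
Two vertices are in the same tree of `F` iff `F.Reachable` holds for them. -/
def IsSpanningForest {V : Type*} (G : SimpleGraph V) (r : ℕ) (F : SimpleGraph V) : Prop :=
  F ≤ G ∧ F.IsAcyclic ∧ Nat.card F.ConnectedComponent = r

open Classical in
/-- The product of the weights of the edges of `F`. -/
noncomputable def forestWeight {V R : Type*} [Fintype V] [CommRing R] (w : Sym2 V → R)
    (F : SimpleGraph V) : R :=
  ∏ e ∈ F.edgeFinset, w e

/-- A pair of forests is forbidden if two different marked vertices (the values of `v`) are in the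
same tree of both forests. -/
def IsForbidden {V ι : Type*} (v : ι → V) (F F' : SimpleGraph V) : Prop :=
  ∃ a b : ι, a ≠ b ∧ F.Reachable (v a) (v b) ∧ F'.Reachable (v a) (v b)

/-- The pairs of a spanning tree and a `(k+1)`-forest of `G` with the `k+1` marked vertices
in different trees. -/
def leftPairs {V : Type*} {k : ℕ} (G : SimpleGraph V) (v : Fin (k + 1) → V) :
    Set (SimpleGraph V × SimpleGraph V) :=
  {p | IsSpanningForest G 1 p.1 ∧ IsSpanningForest G (k + 1) p.2 ∧
    ∀ a b, a ≠ b → ¬ p.2.Reachable (v a) (v b)}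

/-- The non-forbidden pairs of a `2`-forest and a `k`-forest of `G` such that the marked vertices
`c` and `j` are in different trees of the `2`-forest, and the `k` marked vertices other than `j`
are in different trees of the `k`-forest (so that `j` shares its tree in the `k`-forest with
exactly one other marked vertex). -/
def rightPairs {V : Type*} {k : ℕ} (G : SimpleGraph V) (v : Fin (k + 1) → V)
    (c j : Fin (k + 1)) : Set (SimpleGraph V × SimpleGraph V) :=
  {p | IsSpanningForest G 2 p.1 ∧ IsSpanningForest G k p.2 ∧ ¬ IsForbidden v p.1 p.2 ∧
    ¬ p.1.Reachable (v c) (v j) ∧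
    ∀ a b, a ≠ j → b ≠ j → a ≠ b → ¬ p.2.Reachable (v a) (v b)}

open Classical in
/-- The generating function of a set of pairs of forests: each pair contributes the product of the
weights of its two forests. With indeterminates as weights it records the edges of both forests
with multiplicity; with all weights `1` it is the number of pairs. -/
noncomputable def pairSum {V R : Type*} [Fintype V] [CommRing R] (w : Sym2 V → R)
    (S : Set (SimpleGraph V × SimpleGraph V)) : R :=
  ∑ p : SimpleGraph V × SimpleGraph V with p ∈ S, forestWeight w p.1 * forestWeight w p.2

/-! Each minor of the Laplacian is a signed sum over forests, so the right side is a signed sum over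
pairs. Write `i` also for the marked vertex at position `i` of `M`. The signed minor `det(M_{i,j'})`
is an adjugate entry of `M` and sums the 2-forests in which `i` and `j` share a tree that avoids
`c`. The second factor sums, for `i = j`, the `k`-forests separating the marked vertices other than
`j`; for `i ≠ j` it is minus the sum of those that also join `i` to `j`. So the term `i = j` gives
all pairs with the required separations, and the term `i ≠ j` subtracts those in which `i` and `j`
are together in both forests. The `k`-forest can only join `j` to another marked vertex, and to at
most one, so the subtraction removes each forbidden pair exactly once (`pairSum_rightPairs`).

The forest sums come from a matrix-tree theorem for parent functions (`det_groundedLaplacian`):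
expanding a determinant along all rows chooses a parent for each non-root, and a choice contributes
its weight if it leads every vertex to a root, and zero if it creates a cycle. Cofactors follow by
linearity in one row (`det_updateRow_groundedLaplacian`), and `sum_isFlow_eq_sum_isRootedForest`
passes from parent functions to forests.

The identity holds for every matrix (`sum_adjugate_mul_det_submatrix_cons`): the second factor is
linear in row `i` of `M` with coefficients independent of `i`, so `adj(M) M = det(M)` collapses the
sum. -/

/-! ### Parent functions and the directed matrix-tree theorem -/

/-- The map `f` fixes the points of `S`, and its iterates send every point into `S`. -/
def IsFlow {V : Type*} (S : Finset V) (f : V → V) : Prop :=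
  (∀ s ∈ S, f s = s) ∧ ∀ u, ∃ m, f^[m] u ∈ S

theorem IsFlow.induction {V : Type*} {S : Finset V} {f : V → V} (hf : IsFlow S f) {P : V → Prop}
    (h0 : ∀ s ∈ S, P s) (h1 : ∀ u, u ∉ S → P (f u) → P u) (u : V) : P u := by
  obtain ⟨m, hm⟩ := hf.2 u
  induction m generalizing u with
  | zero => exact h0 u hm
  | succ m ih =>
    by_cases hu : u ∈ S
    · exact h0 u hu
    · exact h1 u hu (ih (f u) (by simpa using hm))

theorem IsFlow.mem_of_fixed {V : Type*} {S : Finset V} {f : V → V} (hf : IsFlow S f) (u : V) :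
    f u = u → u ∈ S := by
  refine hf.induction (P := fun u => f u = u → u ∈ S) (fun s hs _ => hs) (fun u _ ih h => ?_) u
  have := ih (by rw [h, h])
  rwa [h] at this

/-- The matrix whose row `u` is `e_u` if `u ∈ S`, and `e_u - e_{f u}` otherwise. -/
def flowMatrix {V : Type*} (R : Type*) [CommRing R] [DecidableEq V] (S : Finset V) (f : V → V) :
    Matrix V V R :=
  Matrix.of fun u => if u ∈ S then Pi.single u 1 else Pi.single u 1 - Pi.single (f u) 1

/-- Only the identity permutation survives in the Leibniz formula: a nonzero term forces `σ⁻¹ x` to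
be `x` or `f x`, and following `f` to `S` then shows that `σ` moves nothing. -/
theorem det_flowMatrix_of_isFlow {V R : Type*} [CommRing R] [Fintype V] [DecidableEq V]
    {S : Finset V} {f : V → V} (hf : IsFlow S f) : (flowMatrix R S f).det = 1 := by
  rw [Matrix.det_apply, Finset.sum_eq_single 1]
  · rw [Equiv.Perm.sign_one, one_smul]
    refine Finset.prod_eq_one fun u _ => ?_
    by_cases hu : u ∈ S
    · simp [flowMatrix, hu]
    · have : f u ≠ u := fun h => hu (hf.mem_of_fixed u h)
      simp [flowMatrix, hu, this.symm]
  · intro σ _ hσ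
    suffices ∃ u, flowMatrix R S f (σ u) u = 0 by
      obtain ⟨u, hu⟩ := this
      have h0 : ∏ x, flowMatrix R S f (σ x) x = 0 := Finset.prod_eq_zero (Finset.mem_univ u) hu
      simp only [h0, smul_zero]
    by_contra! h
    have h' : ∀ x, σ⁻¹ x = x ∨ (x ∉ S ∧ σ⁻¹ x = f x) := by
      intro x
      have hx := h (σ⁻¹ x)
      rw [show σ (σ⁻¹ x) = x from σ.apply_symm_apply x] at hx
      by_contra! hc
      apply hx
      by_cases hS : x ∈ S
      · exact (congrFun (if_pos hS) _).trans (Pi.single_eq_of_ne hc.1 _)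
      · refine (congrFun (if_neg hS) _).trans ?_
        rw [Pi.sub_apply, Pi.single_eq_of_ne hc.1, Pi.single_eq_of_ne (hc.2 hS), sub_zero]
    apply hσ
    rw [← inv_eq_one]
    ext x
    refine hf.induction (P := fun x => σ⁻¹ x = x) (fun s hs => ?_) (fun u _ ih => ?_) x
    · rcases h' s with h | h
      · exact h
      · exact absurd hs h.1
    · rcases h' u with h | h
      · exact h
      -- `σ⁻¹` takes the value `f u` at `u` and, by induction, at `f u`, so `f u = u`.
      · have := σ⁻¹.injective (h.2.trans ih.symm)
        rw [h.2, ← this]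
  · simp

/-- The indicator `z` of the points that never reach `S` lies in the kernel. Multiplying by the
adjugate gives `det • z = 0`, and `z` has an entry `1`, so this works over any commutative ring. -/
theorem det_flowMatrix_of_not_isFlow {V R : Type*} [CommRing R] [Fintype V] [DecidableEq V]
    {S : Finset V} {f : V → V} (hS : ∀ s ∈ S, f s = s) (hf : ¬ IsFlow S f) :
    (flowMatrix R S f).det = 0 := by
  classical
  have : ∃ u, ∀ m, f^[m] u ∉ S := by
    by_contra! h
    exact hf ⟨hS, h⟩
  obtain ⟨u, hu⟩ := this
  let z : V → R := fun x => if ∀ m, f^[m] x ∉ S then 1 else 0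
  have hz : ∀ x, x ∉ S → z (f x) = z x := by
    intro x hx
    have : (∀ m, f^[m] (f x) ∉ S) ↔ ∀ m, f^[m] x ∉ S := by
      refine ⟨fun h m => ?_, fun h m => ?_⟩
      · cases m with
        | zero => exact hx
        | succ m => exact h m
      · exact h (m + 1)
    simp only [z, this]
  have hmul : (flowMatrix R S f).mulVec z = 0 := by
    ext x
    by_cases hx : x ∈ S
    · have : ¬ ∀ m, f^[m] x ∉ S := fun h => h 0 hx
      simp [Matrix.mulVec, flowMatrix, hx, z, this]
    · have hrow : flowMatrix R S f x = Pi.single x 1 - Pi.single (f x) 1 := if_neg hx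
      change flowMatrix R S f x ⬝ᵥ z = 0
      rw [hrow, sub_dotProduct, single_one_dotProduct, single_one_dotProduct, hz x hx, sub_self]
  have h1 : (flowMatrix R S f).det • z = 0 := by
    rw [← Matrix.one_mulVec z, ← Matrix.smul_mulVec, ← Matrix.adjugate_mul,
      ← Matrix.mulVec_mulVec, hmul, Matrix.mulVec_zero]
  simpa [z, hu] using congrFun h1 u

/-- The matrix whose row `u` is `e_u` if `u ∈ S`, and `∑ y, p u y • (e_u - e_y)` otherwise: the
Laplacian of the directed weights `p`, grounded at `S`. -/
def groundedLaplacian {V R : Type*} [CommRing R] [Fintype V] [DecidableEq V] (S : Finset V)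
    (p : V → V → R) : Matrix V V R :=
  Matrix.of fun u => if u ∈ S then Pi.single u 1 else
    ∑ y, p u y • (Pi.single u 1 - Pi.single y 1)

open Classical in
/-- The matrix-tree theorem for directed weights: forests that are directed towards the set `S` of
roots are given by their parent functions. -/
theorem det_groundedLaplacian {V R : Type*} [CommRing R] [Fintype V] [DecidableEq V]
    (S : Finset V) (p : V → V → R) :
    (groundedLaplacian S p).det = ∑ f : V → V with IsFlow S f, ∏ u ∈ Sᶜ, p u (f u) := by
  -- Root rows also become sums over `y`, with a single nonzero coefficient at `y = u`, so that
  -- multilinearity applies uniformly to all rows.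
  let q : V → V → R := fun u y => if u ∈ S then (if y = u then 1 else 0) else p u y
  let g : V → V → V → R := fun u y =>
    if u ∈ S then Pi.single u 1 else Pi.single u 1 - Pi.single y 1
  have h1 : groundedLaplacian S p = fun u => ∑ y, q u y • g u y := by
    funext u
    by_cases hu : u ∈ S
    · change (if u ∈ S then _ else _) = _
      simp [q, g, hu]
    · change (if u ∈ S then _ else _) = _
      simp [q, g, hu]
  have h2 : (groundedLaplacian S p).det
      = ∑ f : V → V, (∏ u, q u (f u)) * (flowMatrix R S f).det := by
    rw [h1]
    change Matrix.detRowAlternating.toMultilinearMap _ = _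
    rw [MultilinearMap.map_sum]
    refine Finset.sum_congr rfl fun f _ => ?_
    rw [MultilinearMap.map_smul_univ]
    rfl
  rw [h2, Finset.sum_filter]
  refine Finset.sum_congr rfl fun f _ => ?_
  have hq : (∏ u, q u (f u)) = (∏ u ∈ S, if f u = u then 1 else 0) * ∏ u ∈ Sᶜ, p u (f u) := by
    rw [← Finset.prod_mul_prod_compl S]
    congr 1
    · exact Finset.prod_congr rfl fun u hu => by simp [q, hu]
    · exact Finset.prod_congr rfl fun u hu => by simp [q, Finset.mem_compl.1 hu]
  by_cases hS : ∀ s ∈ S, f s = s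
  · rw [hq, Finset.prod_eq_one (s := S) fun u hu => if_pos (hS u hu), one_mul]
    split_ifs with hf
    · rw [det_flowMatrix_of_isFlow hf, mul_one]
    · rw [det_flowMatrix_of_not_isFlow hS hf, mul_zero]
  · rw [if_neg fun h => hS h.1, hq]
    push Not at hS
    obtain ⟨s, hs, hne⟩ := hS
    rw [Finset.prod_eq_zero hs (if_neg hne), zero_mul, zero_mul]

/-! ### Cofactors by redirecting a root -/

theorem iterate_eq_of_fixed_iff {V : Type*} {f : V → V} {b : V} (hb : f b = b) (u : V) :
    (∃ m, f^[m] u = b) ↔ ∃ m, f^[m] (f u) = b := by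
  refine ⟨fun ⟨m, hm⟩ => ?_, fun ⟨m, hm⟩ => ⟨m + 1, hm⟩⟩
  refine ⟨m, ?_⟩
  rw [← Function.iterate_succ_apply, Function.iterate_succ_apply', hm, hb]

/-- Redirecting the root `b` to `a` gives a flow iff `a` is not in the tree of `b`. -/
theorem isFlow_update_iff {V : Type*} [DecidableEq V] {S : Finset V} {g : V → V} {a b : V}
    (hbS : b ∉ S) (hg : g b = b) :
    IsFlow S (Function.update g b a) ↔ IsFlow (insert b S) g ∧ ¬ ∃ m, g^[m] a = b := by
  have hne : ∀ u, u ≠ b → Function.update g b a u = g u := fun u hu =>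
    Function.update_of_ne hu _ _
  constructor
  · intro hf
    have hfix : ∀ s ∈ S, g s = s := fun s hs => by
      rw [← hne s (by rintro rfl; exact hbS hs), hf.1 s hs]
    refine ⟨⟨fun s hs => ?_, hf.induction (fun s hs => ⟨0, by simp [hs]⟩) fun u _ ih => ?_⟩, ?_⟩
    · rcases Finset.mem_insert.1 hs with rfl | hs
      · exact hg
      · exact hfix s hs
    · by_cases hu : u = b
      · exact ⟨0, by simp [hu]⟩
      · rw [hne u hu] at ih
        obtain ⟨m, hm⟩ := ih
        exact ⟨m + 1, hm⟩
    · intro ha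
      -- If `a` reached `b` under `g`, this induction along the redirected map would show that no
      -- point reaches `b`, not even `b` itself.
      refine hf.induction (P := fun u => ¬ ∃ m, g^[m] u = b) ?_ ?_ b ⟨0, rfl⟩
      · rintro s hs ⟨m, hm⟩
        rw [Function.iterate_fixed (hfix s hs)] at hm
        exact hbS (hm ▸ hs)
      · intro u _ ih h
        apply ih
        by_cases hu : u = b
        · rw [hu, Function.update_self]
          exact ha
        · rw [hne u hu]
          exact (iterate_eq_of_fixed_iff hg u).1 h
  · rintro ⟨hf, ha⟩
    have key : ∀ u, (¬ ∃ m, g^[m] u = b) → ∃ m, (Function.update g b a)^[m] u ∈ S := by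
      refine hf.induction (fun s hs h => ?_) fun u hu ih h => ?_
      · rcases Finset.mem_insert.1 hs with rfl | hs
        · exact absurd ⟨0, rfl⟩ h
        · exact ⟨0, hs⟩
      · rw [iterate_eq_of_fixed_iff hg u] at h
        obtain ⟨m, hm⟩ := ih h
        refine ⟨m + 1, ?_⟩
        rw [Function.iterate_succ_apply, hne u (by rintro rfl; simp at hu)]
        exact hm
    refine ⟨fun s hs => ?_, hf.induction (fun s hs => ?_) fun u hu ih => ?_⟩
    · rw [hne s (by rintro rfl; exact hbS hs), hf.1 s (Finset.mem_insert_of_mem hs)]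
    · rcases Finset.mem_insert.1 hs with rfl | hs
      · obtain ⟨m, hm⟩ := key a ha
        refine ⟨m + 1, ?_⟩
        rwa [Function.iterate_succ_apply, Function.update_self]
      · exact ⟨0, hs⟩
    · obtain ⟨m, hm⟩ := ih
      refine ⟨m + 1, ?_⟩
      rw [Function.iterate_succ_apply, hne u (by rintro rfl; simp at hu)]
      exact hm

open Classical in
/-- The cofactors of a grounded Laplacian. -/
theorem det_updateRow_groundedLaplacian {V R : Type*} [CommRing R] [Fintype V] [DecidableEq V]
    {S : Finset V} (p : V → V → R) {a b : V} (hb : b ∉ S) :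
    ((groundedLaplacian S p).updateRow b (Pi.single a 1)).det =
      ∑ f : V → V with IsFlow (insert b S) f ∧ ∃ m, f^[m] a = b,
        ∏ u ∈ (insert b S)ᶜ, p u (f u) := by
  have h1 : (groundedLaplacian S p).updateRow b (Pi.single b 1)
      = groundedLaplacian (insert b S) p := by
    ext u x
    by_cases hu : u = b
    · subst hu; simp [groundedLaplacian]
    · simp [groundedLaplacian, hu]
  -- The only arc leaving `b` now goes to `a`, with weight 1.
  let p' : V → V → R := Function.update p b (Pi.single a 1)
  have h2 : (groundedLaplacian S p).updateRow b (Pi.single b 1 - Pi.single a 1)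
      = groundedLaplacian S p' := by
    ext u x
    by_cases hu : u = b
    · subst hu
      have hsum : ∑ y, (Pi.single a 1 : V → R) y * ((Pi.single u 1 : V → R) x
          - (Pi.single y 1 : V → R) x) = (Pi.single u 1 : V → R) x - (Pi.single a 1 : V → R) x := by
        rw [Finset.sum_eq_single a (fun y _ hy => by simp [hy]) (by simp)]
        simp
      simp [groundedLaplacian, hb, p', Finset.sum_apply, hsum]
    · simp [groundedLaplacian, hu, p']
  -- Row `b` is split as `e_a = e_b - (e_b - e_a)`. The first part sums all flows with the extra
  -- root `b`, the second those in which `a` is not in the tree of `b`.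
  have h3 : ((groundedLaplacian S p).updateRow b (Pi.single a 1)).det
      = (groundedLaplacian (insert b S) p).det - (groundedLaplacian S p').det := by
    rw [← h1, ← h2, sub_eq_add_neg (Pi.single b 1 : V → R), Matrix.det_updateRow_add,
      ← neg_one_smul R (Pi.single a 1 : V → R), Matrix.det_updateRow_smul]
    ring
  rw [h3, det_groundedLaplacian, det_groundedLaplacian,
    ← Finset.sum_filter_add_sum_filter_not _ (fun f : V → V => ∃ m, f^[m] a = b),
    Finset.filter_filter, Finset.filter_filter, add_sub_assoc, add_eq_left, sub_eq_zero]
  have hcompl : (Sᶜ : Finset V) = insert b (insert b S)ᶜ := by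
    ext u; by_cases hu : u = b <;> simp [hu, hb]
  have hterm : ∀ f : V → V, ∏ u ∈ Sᶜ, p' u (f u)
      = if f b = a then ∏ u ∈ (insert b S)ᶜ, p u (f u) else 0 := by
    intro f
    rw [hcompl, Finset.prod_insert (by simp)]
    have : ∏ u ∈ (insert b S)ᶜ, p' u (f u) = ∏ u ∈ (insert b S)ᶜ, p u (f u) :=
      Finset.prod_congr rfl fun u hu => by
        have : u ≠ b := by rintro rfl; simp at hu
        simp [p', this]
    rw [this]
    simp [p', Pi.single_apply]
  simp_rw [hterm]
  rw [← Finset.sum_filter, Finset.filter_filter]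
  refine Finset.sum_bij' (fun g _ => Function.update g b a) (fun f _ => Function.update f b b)
    ?_ ?_ ?_ ?_ ?_
  · intro g hg
    simp only [Finset.mem_filter, Finset.mem_univ, true_and] at hg ⊢
    exact ⟨(isFlow_update_iff hb (hg.1.1 b (by simp))).2 hg, by simp⟩
  · intro f hf
    simp only [Finset.mem_filter, Finset.mem_univ, true_and] at hf ⊢
    rw [← isFlow_update_iff hb (by simp), Function.update_idem, ← hf.2,
      Function.update_eq_self]
    exact hf.1
  · intro g hg
    simp only [Finset.mem_filter, Finset.mem_univ, true_and] at hg
    conv_rhs => rw [← Function.update_eq_self b g, hg.1.1 b (by simp)]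
    simp
  · intro f hf
    simp only [Finset.mem_filter, Finset.mem_univ, true_and] at hf
    conv_rhs => rw [← Function.update_eq_self b f, hf.2]
    simp
  · intro g _
    refine Finset.prod_congr rfl fun u hu => ?_
    have : u ≠ b := by rintro rfl; simp at hu
    simp [this]

/-! ### Parent functions and rooted forests -/

/-- The graph with the edges joining `u` to `f u`. -/
def flowGraph {V : Type*} (f : V → V) : SimpleGraph V :=
  SimpleGraph.fromRel fun u x => f u = x

theorem flowGraph_adj {V : Type*} {f : V → V} {u x : V} :
    (flowGraph f).Adj u x ↔ u ≠ x ∧ (f u = x ∨ f x = u) := Iff.rfl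

/-- A property that is invariant along the edges of a graph is invariant on its components. -/
theorem SimpleGraph.Reachable.iff_of_adj {V : Type*} {F : SimpleGraph V} {P : V → Prop}
    (h : ∀ u x, F.Adj u x → (P u ↔ P x)) {a b : V} (hab : F.Reachable a b) : P a ↔ P b := by
  obtain ⟨p⟩ := hab
  induction p with
  | nil => rfl
  | cons hadj _ ih => exact (h _ _ hadj).trans ih

theorem flowGraph_reachable_apply {V : Type*} (f : V → V) (u : V) :
    (flowGraph f).Reachable u (f u) := by
  by_cases h : u = f u
  · rw [← h]
  · exact SimpleGraph.Adj.reachable (flowGraph_adj.2 ⟨h, Or.inl rfl⟩)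

theorem flowGraph_reachable_iterate {V : Type*} (f : V → V) (m : ℕ) (u : V) :
    (flowGraph f).Reachable u (f^[m] u) := by
  induction m with
  | zero => rfl
  | succ m ih =>
    rw [Function.iterate_succ_apply']
    exact ih.trans (flowGraph_reachable_apply f _)

theorem flowGraph_reachable_iff {V : Type*} {f : V → V} {a b : V} (hb : f b = b) :
    (flowGraph f).Reachable a b ↔ ∃ m, f^[m] a = b := by
  refine ⟨fun h => ?_, fun ⟨m, hm⟩ => hm ▸ flowGraph_reachable_iterate f m a⟩
  refine (h.iff_of_adj (P := fun u => ∃ m, f^[m] u = b) fun u x hux => ?_).2 ⟨0, rfl⟩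
  rcases (flowGraph_adj.1 hux).2 with rfl | rfl
  · exact iterate_eq_of_fixed_iff hb u
  · exact (iterate_eq_of_fixed_iff hb x).symm

theorem IsFlow.separated {V : Type*} {S : Finset V} {f : V → V} (hf : IsFlow S f) {s t : V}
    (hs : s ∈ S) (ht : t ∈ S) (hst : s ≠ t) : ¬ (flowGraph f).Reachable s t := by
  rw [flowGraph_reachable_iff (hf.1 t ht)]
  rintro ⟨m, hm⟩
  rw [Function.iterate_fixed (hf.1 s hs)] at hm
  exact hst hm

/-- Every edge is a bridge: "some iterate equals `u`" is invariant along all edges except the one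
from `u` to `f u`. If that edge were not a bridge, `f u` would return to `u`, and this cycle would
never reach `S`. -/
theorem IsFlow.isAcyclic {V : Type*} {S : Finset V} {f : V → V} (hf : IsFlow S f) :
    (flowGraph f).IsAcyclic := by
  have key : ∀ u, u ≠ f u → ¬ ((flowGraph f).deleteEdges {s(u, f u)}).Reachable u (f u) := by
    intro u hu h
    have hcyc : ∃ m, f^[m] (f u) = u := by
      refine (h.iff_of_adj (P := fun x => ∃ m, f^[m] x = u) fun x y hxy => ?_).1 ⟨0, rfl⟩
      rw [SimpleGraph.deleteEdges_adj] at hxy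
      have step : ∀ x, x ≠ u → ((∃ m, f^[m] x = u) ↔ ∃ m, f^[m] (f x) = u) := by
        refine fun x hx => ⟨?_, fun ⟨m, hm⟩ => ⟨m + 1, hm⟩⟩
        rintro ⟨_ | m, hm⟩
        · exact absurd hm hx
        · exact ⟨m, hm⟩
      rcases (flowGraph_adj.1 hxy.1).2 with rfl | rfl
      · exact step x (by rintro rfl; exact hxy.2 rfl)
      · exact (step y (by rintro rfl; exact hxy.2 Sym2.eq_swap)).symm
    have huS : u ∉ S := fun hs => hu (hf.1 u hs).symm
    refine hf.induction (P := fun x => ¬ ∃ m, f^[m] x = u) ?_ ?_ u ⟨0, rfl⟩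
    · rintro s hs ⟨m, hm⟩
      rw [Function.iterate_fixed (hf.1 s hs)] at hm
      exact huS (hm ▸ hs)
    · rintro x _ ih ⟨_ | m, hm⟩
      · obtain rfl : x = u := hm
        exact ih hcyc
      · exact ih ⟨m, hm⟩
  rw [SimpleGraph.isAcyclic_iff_forall_isBridge]
  intro e he
  induction e with
  | h u x =>
    rw [SimpleGraph.mem_edgeSet, flowGraph_adj] at he
    rw [SimpleGraph.isBridge_iff]
    obtain ⟨hne, rfl | rfl⟩ := he
    · exact key u hne
    · rw [SimpleGraph.reachable_comm, Sym2.eq_swap]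
      exact key x hne.symm

/-- If the vertices in `S` are in different components, the number of components is `|S|` iff every
vertex is in the component of a vertex in `S`. -/
theorem card_connectedComponent_eq_iff {V : Type*} [Finite V] {F : SimpleGraph V} {S : Finset V}
    (hS : ∀ s ∈ S, ∀ t ∈ S, s ≠ t → ¬ F.Reachable s t) :
    Nat.card F.ConnectedComponent = S.card ↔ ∀ u, ∃ s ∈ S, F.Reachable u s := by
  let φ : S → F.ConnectedComponent := fun s => F.connectedComponentMk s
  have hφ : Function.Injective φ := by
    intro s t hst
    by_contra hne
    exact hS s s.2 t t.2 (fun h => hne (Subtype.ext h)) (SimpleGraph.ConnectedComponent.exact hst)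
  have hsurj : Function.Surjective φ ↔ ∀ u, ∃ s ∈ S, F.Reachable u s := by
    constructor
    · intro h u
      obtain ⟨s, hs⟩ := h (F.connectedComponentMk u)
      exact ⟨s, s.2, (SimpleGraph.ConnectedComponent.exact hs).symm⟩
    · intro h C
      induction C using SimpleGraph.ConnectedComponent.ind with
      | h u =>
        obtain ⟨s, hs, hus⟩ := h u
        exact ⟨⟨s, hs⟩, SimpleGraph.ConnectedComponent.sound hus.symm⟩
  rw [← hsurj]
  have hc : Nat.card S = S.card := by simp
  rw [← hc]
  constructor
  · intro h
    exact ((Nat.bijective_iff_injective_and_card φ).2 ⟨hφ, h.symm⟩).2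
  · intro h
    exact (Nat.card_eq_of_bijective φ ⟨hφ, h⟩).symm

/-- Two flows with the same graph are equal. -/
theorem IsFlow.eq_of_flowGraph_eq {V : Type*} {S : Finset V} {f g : V → V} (hf : IsFlow S f)
    (hg : IsFlow S g) (h : flowGraph f = flowGraph g) : f = g := by
  funext u
  refine hf.induction (P := fun u => f u = g u) (fun s hs => ?_) (fun u hu ih => ?_) u
  · rw [hf.1 s hs, hg.1 s hs]
  · have hne : u ≠ f u := fun h => hu (hf.mem_of_fixed u h.symm)
    have hadj : (flowGraph g).Adj u (f u) := h ▸ flowGraph_adj.2 ⟨hne, Or.inl rfl⟩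
    rcases (flowGraph_adj.1 hadj).2 with h1 | h1
    · exact h1.symm
    · exfalso
      -- Here `f` swaps `u` and `f u`, so neither can reach `S`.
      refine hf.induction (P := fun x => x ≠ u ∧ x ≠ f u) ?_ ?_ u |>.1 rfl
      · intro s hs
        refine ⟨fun h => hu (h ▸ hs), fun h => hne ?_⟩
        have := hf.1 s hs
        rw [h] at this
        exact h1.symm.trans (ih.symm.trans this)
      · intro x _ hx
        refine ⟨?_, ?_⟩
        · rintro rfl
          exact hx.2 rfl
        · rintro rfl
          exact hx.1 (by rw [ih, h1])

/-- The distance to the root decreases along a suitable parent function of a rooted forest. -/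
theorem exists_flowGraph_eq {V : Type*} [Finite V] {F : SimpleGraph V} {S : Finset V}
    (hF : F.IsAcyclic) (hS : ∀ s ∈ S, ∀ t ∈ S, s ≠ t → ¬ F.Reachable s t)
    (hr : ∀ u, ∃ s ∈ S, F.Reachable u s) : ∃ f, IsFlow S f ∧ flowGraph f = F := by
  choose r hrS hr using hr
  -- The parent of a non-root is the second vertex of a shortest walk to its root.
  have hadj : ∀ u, ∃ y, (u ∈ S → y = u) ∧
      (u ∉ S → F.Adj u y ∧ r y = r u ∧ F.dist y (r y) < F.dist u (r u)) := by
    intro u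
    by_cases hu : u ∈ S
    · exact ⟨u, fun _ => rfl, fun h => absurd hu h⟩
    · obtain ⟨p, hp⟩ := (hr u).exists_walk_length_eq_dist
      have hne : u ≠ r u := fun h => hu (h ▸ hrS u)
      obtain ⟨y, h, q, hq⟩ := SimpleGraph.Walk.exists_eq_cons_of_ne hne p
      have hy : r y = r u := by
        by_contra hc
        exact hS _ (hrS y) _ (hrS u) hc ((hr y).symm.trans ⟨q⟩)
      refine ⟨y, fun h => absurd h hu, fun _ => ⟨h, hy, ?_⟩⟩
      rw [hy, ← hp, hq, SimpleGraph.Walk.length_cons]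
      exact Nat.lt_succ_of_le (SimpleGraph.dist_le q)
  choose f hfS hf using hadj
  have hflow : IsFlow S f := by
    refine ⟨hfS, fun u => ?_⟩
    induction hd : F.dist u (r u) using Nat.strong_induction_on generalizing u with
    | _ d ih =>
      by_cases hu : u ∈ S
      · exact ⟨0, hu⟩
      · obtain ⟨m, hm⟩ := ih _ (hd ▸ (hf u hu).2.2) (f u) rfl
        exact ⟨m + 1, hm⟩
  have hstep : ∀ u, u ≠ f u → F.Adj u (f u) := fun u hu =>
    (hf u fun h => hu (hfS u h).symm).1
  have hle : flowGraph f ≤ F := by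
    intro u x hux
    obtain ⟨hne, rfl | rfl⟩ := flowGraph_adj.1 hux
    · exact hstep u hne
    · exact (hstep x hne.symm).symm
  refine ⟨f, hflow, le_antisymm hle fun u x hux => ?_⟩
  -- An edge of `F` missing from the flow graph would not be a bridge, since its ends are joined in
  -- the flow graph through their common root.
  by_contra hnot
  have hroot : ∀ u, (flowGraph f).Reachable u (r u) := by
    intro u
    obtain ⟨m, hm⟩ := hflow.2 u
    have h1 := flowGraph_reachable_iterate f m u
    have : f^[m] u = r u := by
      by_contra hc
      exact hS _ hm _ (hrS u) hc ((h1.mono hle).symm.trans (hr u))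
    rwa [this] at h1
  have hrux : r u = r x := by
    by_contra hc
    exact hS _ (hrS u) _ (hrS x) hc ((hr u).symm.trans (hux.reachable.trans (hr x)))
  have h1 : (flowGraph f).Reachable u x := (hroot u).trans (hrux ▸ (hroot x).symm)
  have h2 := SimpleGraph.isAcyclic_iff_forall_isBridge.1 hF (F.mem_edgeSet.2 hux)
  rw [SimpleGraph.isBridge_iff] at h2
  refine h2 (h1.mono fun y z hyz => ?_)
  rw [SimpleGraph.deleteEdges_adj]
  refine ⟨hle hyz, fun he => hnot ?_⟩
  have he : s(y, z) = s(u, x) := he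
  rw [← SimpleGraph.mem_edgeSet, ← he]
  exact hyz

/-- The spanning forests of `G` with `|S|` trees, such that the vertices in `S` are in different
trees. -/
def IsRootedForest {V : Type*} (G : SimpleGraph V) (S : Finset V) (F : SimpleGraph V) : Prop :=
  IsSpanningForest G S.card F ∧ ∀ s ∈ S, ∀ t ∈ S, s ≠ t → ¬ F.Reachable s t

theorem IsFlow.isRootedForest {V : Type*} [Finite V] {G : SimpleGraph V} {S : Finset V}
    {f : V → V} (hf : IsFlow S f) (hG : flowGraph f ≤ G) : IsRootedForest G S (flowGraph f) := by
  have hs : ∀ s ∈ S, ∀ t ∈ S, s ≠ t → ¬ (flowGraph f).Reachable s t :=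
    fun s hs t ht hst => hf.separated hs ht hst
  refine ⟨⟨hG, hf.isAcyclic, (card_connectedComponent_eq_iff hs).2 fun u => ?_⟩, hs⟩
  obtain ⟨m, hm⟩ := hf.2 u
  exact ⟨_, hm, flowGraph_reachable_iterate f m u⟩

-- Each non-root owns the edge to its parent. Two non-roots owning the same edge would form a
-- 2-cycle of `f`.
open Classical in
theorem IsFlow.prod_edgeWeight {V R : Type*} [Fintype V] [DecidableEq V] [CommRing R]
    {G : SimpleGraph V} {S : Finset V} (w : Sym2 V → R) {f : V → V} (hf : IsFlow S f)
    (hG : flowGraph f ≤ G) :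
    ∏ u ∈ Sᶜ, edgeWeight G w u (f u) = forestWeight w (flowGraph f) := by
  have hne : ∀ u ∉ S, u ≠ f u := fun u hu h => hu (hf.mem_of_fixed u h.symm)
  have hadj : ∀ u ∉ S, (flowGraph f).Adj u (f u) := fun u hu =>
    flowGraph_adj.2 ⟨hne u hu, Or.inl rfl⟩
  unfold forestWeight
  refine Finset.prod_bij (fun u _ => s(u, f u)) ?_ ?_ ?_ ?_
  · intro u hu
    rw [SimpleGraph.mem_edgeFinset, SimpleGraph.mem_edgeSet]
    exact hadj u (Finset.mem_compl.1 hu)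
  · intro u hu x hx h
    by_contra hux
    rcases Sym2.eq_iff.1 h with h | ⟨h1, h2⟩
    · exact hux h.1
    · refine hf.induction (P := fun y => y ≠ u ∧ y ≠ x) ?_ ?_ u |>.1 rfl
      · intro s hs
        exact ⟨fun h => Finset.mem_compl.1 hu (h ▸ hs), fun h => Finset.mem_compl.1 hx (h ▸ hs)⟩
      · intro y _ hy
        refine ⟨?_, ?_⟩
        · rintro rfl
          exact hy.2 h2
        · rintro rfl
          exact hy.1 h1.symm
  · intro e he
    induction e with
    | h u x =>
      rw [SimpleGraph.mem_edgeFinset, SimpleGraph.mem_edgeSet] at he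
      obtain ⟨hux, rfl | rfl⟩ := flowGraph_adj.1 he
      · exact ⟨u, Finset.mem_compl.2 fun h => hux (hf.1 u h).symm, rfl⟩
      · exact ⟨x, Finset.mem_compl.2 fun h => hux (hf.1 x h), Sym2.eq_swap⟩
  · intro u hu
    exact if_pos (hG (hadj u (Finset.mem_compl.1 hu)))

-- Parent functions using a non-edge of `G` have weight 0. The predicate `Q` carries the
-- connectivity condition needed for cofactors.
open Classical in
theorem sum_isFlow_eq_sum_isRootedForest {V R : Type*} [Fintype V] [DecidableEq V] [CommRing R]
    (G : SimpleGraph V) (w : Sym2 V → R) (S : Finset V) (Q : SimpleGraph V → Prop) :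
    ∑ f : V → V with IsFlow S f ∧ Q (flowGraph f), ∏ u ∈ Sᶜ, edgeWeight G w u (f u) =
      ∑ F : SimpleGraph V with IsRootedForest G S F ∧ Q F, forestWeight w F := by
  rw [← Finset.sum_filter_of_ne (p := fun f : V → V => flowGraph f ≤ G)]
  · rw [Finset.filter_filter]
    refine Finset.sum_bij (fun f _ => flowGraph f) ?_ ?_ ?_ ?_
    · intro f hf
      simp only [Finset.mem_filter, Finset.mem_univ, true_and] at hf ⊢
      exact ⟨hf.1.1.isRootedForest hf.2, hf.1.2⟩
    · intro f hf g hg h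
      simp only [Finset.mem_filter, Finset.mem_univ, true_and] at hf hg
      exact hf.1.1.eq_of_flowGraph_eq hg.1.1 h
    · intro F hF
      simp only [Finset.mem_filter, Finset.mem_univ, true_and] at hF
      obtain ⟨⟨hF, hs⟩, hQ⟩ := hF
      obtain ⟨f, hf, rfl⟩ := exists_flowGraph_eq hF.2.1 hs
        ((card_connectedComponent_eq_iff hs).1 hF.2.2)
      exact ⟨f, by simpa using ⟨⟨hf, hQ⟩, hF.1⟩, rfl⟩
    · intro f hf
      simp only [Finset.mem_filter, Finset.mem_univ, true_and] at hf
      exact hf.1.1.prod_edgeWeight w hf.2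
  · intro f hf hprod u x hux
    simp only [Finset.mem_filter, Finset.mem_univ, true_and] at hf
    have key : ∀ u, u ≠ f u → G.Adj u (f u) := by
      intro u hu
      by_contra hc
      exact hprod (Finset.prod_eq_zero
        (Finset.mem_compl.2 fun h => hu (hf.1.1 u h).symm) (if_neg hc))
    obtain ⟨hux, rfl | rfl⟩ := flowGraph_adj.1 hux
    · exact key u hux
    · exact (key x hux.symm).symm

/-! ### Minors of the weighted Laplacian -/

theorem groundedLaplacian_edgeWeight {V R : Type*} [CommRing R] [Fintype V] [DecidableEq V]
    (G : SimpleGraph V) (w : Sym2 V → R) (S : Finset V) {u : V} (hu : u ∉ S) :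
    groundedLaplacian S (edgeWeight G w) u = weightedLaplacian G w u := by
  have hrow : groundedLaplacian S (edgeWeight G w) u =
    ∑ y, edgeWeight G w u y • (Pi.single u 1 - Pi.single y 1) := if_neg hu
  rw [hrow]
  ext x
  simp only [Finset.sum_apply, Pi.smul_apply, Pi.sub_apply, smul_eq_mul, weightedLaplacian,
    Matrix.of_apply]
  split_ifs with hux
  · subst hux
    rw [← Finset.add_sum_erase _ _ (Finset.mem_univ u), sub_self, mul_zero, zero_add]
    refine Finset.sum_congr rfl fun y hy => ?_
    rw [Pi.single_eq_same, Pi.single_eq_of_ne (Finset.ne_of_mem_erase hy).symm, sub_zero, mul_one]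
  · rw [Finset.sum_eq_single x]
    · rw [Pi.single_eq_same, Pi.single_eq_of_ne (Ne.symm hux)]
      ring
    · intro y _ hy
      rw [Pi.single_eq_of_ne (Ne.symm hux), Pi.single_eq_of_ne hy.symm]
      ring
    · simp

open Classical in
/-- The matrix-tree theorem for the principal minors of the weighted Laplacian. -/
theorem det_groundedLaplacian_edgeWeight {V R : Type*} [CommRing R] [Fintype V] [DecidableEq V]
    (G : SimpleGraph V) (w : Sym2 V → R) (S : Finset V) :
    (groundedLaplacian S (edgeWeight G w)).det =
      ∑ F : SimpleGraph V with IsRootedForest G S F, forestWeight w F := by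
  have h := sum_isFlow_eq_sum_isRootedForest G w S fun _ => True
  simp only [and_true] at h
  rw [det_groundedLaplacian]
  convert h

open Classical in
/-- The matrix-tree theorem for the minors of the weighted Laplacian in which the sets of removed
rows and columns differ in one element. -/
theorem det_updateRow_groundedLaplacian_edgeWeight {V R : Type*} [CommRing R] [Fintype V]
    [DecidableEq V] (G : SimpleGraph V) (w : Sym2 V → R) {S : Finset V} {a b : V} (hb : b ∉ S) :
    ((groundedLaplacian S (edgeWeight G w)).updateRow b (Pi.single a 1)).det =
      ∑ F : SimpleGraph V with IsRootedForest G (insert b S) F ∧ F.Reachable a b,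
        forestWeight w F := by
  have h := sum_isFlow_eq_sum_isRootedForest G w (insert b S) fun F => F.Reachable a b
  rw [det_updateRow_groundedLaplacian _ hb]
  convert h using 3 with f
  refine and_congr_right fun hf => ?_
  rw [flowGraph_reachable_iff (hf.1 b (Finset.mem_insert_self _ _))]

/-- Rows that are unit vectors on the diagonal can be removed with their columns. -/
theorem det_submatrix_of_unit_rows {V ι R : Type*} [CommRing R] [Fintype V] [DecidableEq V]
    [Fintype ι] [DecidableEq ι] (A : Matrix V V R) {g : ι → V} (hg : Function.Injective g)
    (hA : ∀ s, s ∉ Set.range g → A s = Pi.single s 1) : (A.submatrix g g).det = A.det := by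
  classical
  rw [Matrix.twoBlockTriangular_det A (fun x => x ∈ Set.range g)]
  · have h1 : (A.toSquareBlockProp fun x => ¬ x ∈ Set.range g) = 1 := by
      ext x y
      rw [Matrix.toSquareBlockProp_def, Matrix.of_apply, hA x x.2, Matrix.one_apply,
        Pi.single_apply]
      simp only [Subtype.ext_iff, eq_comm]
    rw [h1, Matrix.det_one, mul_one]
    convert Matrix.det_submatrix_equiv_self (Equiv.ofInjective g hg)
      (A.toSquareBlockProp fun x => x ∈ Set.range g)
    rfl
  · intro x hx y hy
    rw [hA x hx, Pi.single_eq_of_ne (by rintro rfl; exact hx hy)]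

theorem det_weightedLaplacian_submatrix {V ι R : Type*} [CommRing R] [Fintype V] [DecidableEq V]
    [Fintype ι] [DecidableEq ι] (G : SimpleGraph V) (w : Sym2 V → R) {S : Finset V} {g : ι → V}
    (hg : Function.Injective g) (hS : ∀ s, s ∈ S ↔ s ∉ Set.range g) :
    ((weightedLaplacian G w).submatrix g g).det
      = (groundedLaplacian S (edgeWeight G w)).det := by
  rw [← det_submatrix_of_unit_rows _ hg fun s hs =>
    show groundedLaplacian S (edgeWeight G w) s = _ from if_pos ((hS s).2 hs)]
  congr 1
  ext x y
  rw [Matrix.submatrix_apply, Matrix.submatrix_apply,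
    groundedLaplacian_edgeWeight _ _ _ fun h => (hS _).1 h ⟨x, rfl⟩]

theorem adjugate_weightedLaplacian_submatrix {V ι R : Type*} [CommRing R] [Fintype V]
    [DecidableEq V] [Fintype ι] [DecidableEq ι] (G : SimpleGraph V) (w : Sym2 V → R)
    {S : Finset V} {g : ι → V} (hg : Function.Injective g) (hS : ∀ s, s ∈ S ↔ s ∉ Set.range g)
    (a b : ι) :
    ((weightedLaplacian G w).submatrix g g).adjugate a b
      = ((groundedLaplacian S (edgeWeight G w)).updateRow (g b) (Pi.single (g a) 1)).det := by
  rw [← det_submatrix_of_unit_rows _ hg, Matrix.adjugate_apply]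
  · congr 1
    ext x y
    by_cases hx : x = b
    · subst hx
      simp [Pi.single_apply, hg.eq_iff]
    · rw [Matrix.submatrix_apply, Matrix.updateRow_ne hx, Matrix.updateRow_ne (hg.ne hx),
        groundedLaplacian_edgeWeight _ _ _ fun h => (hS _).1 h ⟨x, rfl⟩, Matrix.submatrix_apply]
  · intro s hs
    have hne : s ≠ g b := by
      rintro rfl
      exact hs ⟨b, rfl⟩
    rw [Matrix.updateRow_ne hne]
    exact if_pos ((hS s).2 hs)

/-- A minor whose sets of rows and columns differ in one element is, up to the sign, an entry of
the adjugate of a principal submatrix. -/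
theorem det_submatrix_cons {V R : Type*} [CommRing R] {m : ℕ} (A : Matrix V V R) (a b : V)
    (t : Fin m → V) :
    (A.submatrix (Fin.cons a t : Fin (m + 1) → V) (Fin.cons b t : Fin (m + 1) → V)).det =
      -(A.submatrix (Fin.cons a (Fin.cons b t : Fin (m + 1) → V) : Fin (m + 2) → V)
        (Fin.cons a (Fin.cons b t : Fin (m + 1) → V) : Fin (m + 2) → V)).adjugate 0 1 := by
  rw [Matrix.adjugate_fin_succ_eq_det_submatrix]
  simp only [Fin.val_one, Fin.val_zero, add_zero, pow_one, neg_mul, one_mul, neg_neg]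
  congr 1
  ext x y
  rw [Matrix.submatrix_apply, Matrix.submatrix_apply, Matrix.submatrix_apply]
  refine Fin.cases ?_ (fun x => ?_) x
  · rfl
  · rw [show (1 : Fin (m + 2)).succAbove x.succ = x.succ.succ by
      rw [← Fin.succ_zero_eq_one, Fin.succ_succAbove_succ]; rfl]
    rfl

/-! ### Minors with removed index sets and the column expansion -/

/-- The increasing enumeration of a finite set is unique, so any strictly monotone one may be used.
-/
theorem det_removeRowsCols {R : Type*} [CommRing R] {m n : ℕ} (M : Matrix (Fin n) (Fin n) R)
    {U W : Finset (Fin n)} (h : W.card = U.card) {f g : Fin m → Fin n} (hf : StrictMono f)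
    (hg : StrictMono g) (hfU : ∀ x, f x ∉ U) (hgW : ∀ x, g x ∉ W) (hm : Uᶜ.card = m) :
    (removeRowsCols M U W h).det = (M.submatrix f g).det := by
  subst hm
  unfold removeRowsCols
  rw [Finset.orderEmbOfFin_unique rfl (fun x => Finset.mem_compl.2 (hfU x)) hf,
    Finset.orderEmbOfFin_unique (by rw [Finset.card_compl, Finset.card_compl, h])
      (fun x => Finset.mem_compl.2 (hgW x)) hg]

theorem adjugate_eq_det_removeRowsCols {R : Type*} [CommRing R] {n : ℕ}
    (M : Matrix (Fin n) (Fin n) R) (i j : Fin n) :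
    M.adjugate j i = (-1) ^ ((i : ℕ) + (j : ℕ)) * (removeRowsCols M {i} {j} rfl).det := by
  cases n with
  | zero => exact i.elim0
  | succ n =>
    rw [Matrix.adjugate_fin_succ_eq_det_submatrix, det_removeRowsCols M (U := {i}) (W := {j}) rfl
      (Fin.strictMono_succAbove i) (Fin.strictMono_succAbove j) (by simp) (by simp)
      (by simp [Finset.card_compl])]

theorem mem_firstIdx {k m : ℕ} (h : k ≤ k + m) (x : Fin (k + m)) :
    x ∈ firstIdx h ↔ (x : ℕ) < k := by
  simp only [firstIdx, Finset.mem_map, Finset.mem_univ, true_and]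
  constructor
  · rintro ⟨y, rfl⟩
    exact y.2
  · intro hx
    exact ⟨⟨x, hx⟩, rfl⟩

theorem det_removeRowsCols_firstIdx {R : Type*} [CommRing R] {k m : ℕ} (h : k ≤ k + m)
    (M : Matrix (Fin (k + m)) (Fin (k + m)) R) :
    (removeRowsCols M (firstIdx h) (firstIdx h) rfl).det =
      (M.submatrix (Fin.natAdd k) (Fin.natAdd k)).det := by
  refine det_removeRowsCols M rfl (Fin.strictMono_natAdd k) (Fin.strictMono_natAdd k)
    (fun x => ?_) (fun x => ?_) ?_
  · simp [mem_firstIdx]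
  · simp [mem_firstIdx]
  · simp [Finset.card_compl, firstIdx]

theorem det_removeRowsCols_erase_firstIdx {R : Type*} [CommRing R] {k m : ℕ} (h : k ≤ k + m)
    (M : Matrix (Fin (k + m)) (Fin (k + m)) R) (i j : Fin k) :
    (removeRowsCols M ((firstIdx h).erase (Fin.castLE h i)) ((firstIdx h).erase (Fin.castLE h j))
      (card_erase_firstIdx h i j)).det =
      (M.submatrix (Fin.cons (Fin.castLE h i) (Fin.natAdd k) : Fin (m + 1) → Fin (k + m))
        (Fin.cons (Fin.castLE h j) (Fin.natAdd k) : Fin (m + 1) → Fin (k + m))).det := by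
  have hmono : ∀ i : Fin k, StrictMono
      (Fin.cons (Fin.castLE h i) (Fin.natAdd k) : Fin (m + 1) → Fin (k + m)) := by
    intro i
    refine Fin.strictMono_iff_lt_succ.2 fun x => ?_
    rw [Fin.cons_succ]
    cases m with
    | zero => exact x.elim0
    | succ m =>
      refine Fin.cases ?_ (fun x => ?_) x
      · simp only [Fin.castSucc_zero, Fin.cons_zero, Fin.lt_def, Fin.val_castLE, Fin.val_natAdd]
        omega
      · rw [Fin.castSucc_succ, Fin.cons_succ]
        simp [Fin.lt_def]
  have hnot : ∀ (i : Fin k) (x : Fin (m + 1)),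
      (Fin.cons (Fin.castLE h i) (Fin.natAdd k) : Fin (m + 1) → Fin (k + m)) x ∉
        (firstIdx h).erase (Fin.castLE h i) := by
    intro i x
    refine Fin.cases ?_ (fun x => ?_) x
    · simp
    · simp [mem_firstIdx]
  refine det_removeRowsCols M _ (hmono i) (hmono j) (hnot i) (hnot j) ?_
  rw [Finset.card_compl, Finset.card_erase_of_mem (by simp [mem_firstIdx])]
  have := i.2
  simp only [Fintype.card_fin, firstIdx, Finset.card_map, Finset.card_univ]
  omega

/-- The column expansion identity. -/
theorem sum_adjugate_mul_det_submatrix_cons {R : Type*} [CommRing R] {k m : ℕ}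
    (M : Matrix (Fin (k + m)) (Fin (k + m)) R) (j : Fin k) :
    ∑ i : Fin k, M.adjugate (Fin.castAdd m j) (Fin.castAdd m i) *
      (M.submatrix (Fin.cons (Fin.castAdd m i) (Fin.natAdd k) : Fin (m + 1) → Fin (k + m))
        (Fin.cons (Fin.castAdd m j) (Fin.natAdd k) : Fin (m + 1) → Fin (k + m))).det =
      M.det * (M.submatrix (Fin.natAdd k) (Fin.natAdd k)).det := by
  let r : Fin (m + 1) → Fin (k + m) := Fin.cons (Fin.castAdd m j) (Fin.natAdd k)
  -- The cofactors along the first row of the second minor do not involve that row, hence not `i`.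
  let C : Fin (m + 1) → R := fun l => (-1) ^ (l : ℕ) *
    (M.submatrix (Fin.natAdd k) fun x => r (l.succAbove x)).det
  let D : Fin (k + m) → R := fun i =>
    (M.submatrix (Fin.cons i (Fin.natAdd k) : Fin (m + 1) → Fin (k + m)) r).det
  have hD : ∀ i, D i = ∑ l, M i (r l) * C l := by
    intro i
    simp only [D, C]
    rw [Matrix.det_succ_row_zero]
    refine Finset.sum_congr rfl fun l _ => ?_
    rw [Matrix.submatrix_submatrix, mul_assoc, mul_left_comm]
    rfl
  -- For an index beyond `k` the minor has a repeated row, so the sum may be extended to all rows.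
  have h0 : ∀ x : Fin m, D (Fin.natAdd k x) = 0 := by
    intro x
    refine Matrix.det_zero_of_row_eq (i := 0) (j := x.succ) (Fin.succ_ne_zero x).symm ?_
    ext l
    rfl
  have h1 : ∑ i : Fin k, M.adjugate (Fin.castAdd m j) (Fin.castAdd m i) * D (Fin.castAdd m i)
      = ∑ i, M.adjugate (Fin.castAdd m j) i * D i := by
    rw [Fin.sum_univ_add]
    simp [h0]
  change ∑ i : Fin k, M.adjugate (Fin.castAdd m j) (Fin.castAdd m i) * D (Fin.castAdd m i) = _
  rw [h1]
  simp_rw [hD, Finset.mul_sum]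
  rw [Finset.sum_comm]
  have h2 : ∀ l, ∑ i, M.adjugate (Fin.castAdd m j) i * (M i (r l) * C l)
      = (if l = 0 then M.det else 0) * C l := by
    intro l
    simp_rw [← mul_assoc]
    rw [← Finset.sum_mul, ← Matrix.mul_apply, Matrix.adjugate_mul, Matrix.smul_apply,
      Matrix.one_apply, smul_eq_mul]
    congr 1
    refine Fin.cases ?_ (fun x => ?_) l
    · simp [r]
    · have : Fin.castAdd m j ≠ Fin.natAdd k x := by
        rw [Ne, Fin.ext_iff, Fin.val_castAdd, Fin.val_natAdd]
        omega
      simp [r, this, Fin.succ_ne_zero]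
  simp_rw [h2]
  rw [Finset.sum_eq_single 0 (fun l _ hl => by simp [hl]) (by simp)]
  simp [C, r]

/-! ### Weighted sums over pairs of forests -/

theorem pairSum_prod {V R : Type*} [Fintype V] [DecidableEq V] [CommRing R] (w : Sym2 V → R)
    (A B : SimpleGraph V → Prop) [DecidablePred A] [DecidablePred B] :
    (∑ F : SimpleGraph V with A F, forestWeight w F) *
      (∑ F : SimpleGraph V with B F, forestWeight w F) = pairSum w {p | A p.1 ∧ B p.2} := by
  classical
  rw [Finset.sum_mul_sum, ← Finset.sum_product']
  unfold pairSum
  refine Finset.sum_congr ?_ fun _ _ => rfl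
  ext p
  simp

theorem pairSum_congr {V R : Type*} [Fintype V] [CommRing R] (w : Sym2 V → R)
    {S T : Set (SimpleGraph V × SimpleGraph V)} (h : ∀ p, p ∈ S ↔ p ∈ T) :
    pairSum w S = pairSum w T := by
  rw [Set.ext h]

theorem pairSum_add {V R : Type*} [Fintype V] [CommRing R] (w : Sym2 V → R)
    {S T U : Set (SimpleGraph V × SimpleGraph V)} (h : ∀ p, p ∈ U ↔ p ∈ S ∨ p ∈ T)
    (hd : ∀ p, p ∈ S → p ∉ T) : pairSum w S + pairSum w T = pairSum w U := by
  classical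
  unfold pairSum
  rw [← Finset.sum_union]
  · refine Finset.sum_congr ?_ fun _ _ => rfl
    ext p
    simp [h]
  · rw [Finset.disjoint_filter]
    exact fun p _ => hd p

theorem sum_pairSum {V R ι : Type*} [Fintype V] [CommRing R] (w : Sym2 V → R) (I : Finset ι)
    {S : ι → Set (SimpleGraph V × SimpleGraph V)} {U : Set (SimpleGraph V × SimpleGraph V)}
    (h : ∀ p, p ∈ U ↔ ∃ i ∈ I, p ∈ S i)
    (hd : ∀ p, ∀ i ∈ I, ∀ i' ∈ I, p ∈ S i → p ∈ S i' → i = i') :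
    ∑ i ∈ I, pairSum w (S i) = pairSum w U := by
  classical
  unfold pairSum
  rw [← Finset.sum_biUnion]
  · refine Finset.sum_congr ?_ fun _ _ => rfl
    ext p
    simp [h]
  · intro i hi i' hi' hne
    refine Finset.disjoint_filter.2 fun p _ hp hp' => hne (hd p i hi i' hi' hp hp')

theorem isRootedForest_image {V ι : Type*} [DecidableEq V] {G : SimpleGraph V} {v : ι → V}
    (hv : Function.Injective v) {I : Finset ι} {F : SimpleGraph V} :
    IsRootedForest G (I.image v) F ↔ IsSpanningForest G I.card F ∧
      ∀ a ∈ I, ∀ b ∈ I, a ≠ b → ¬ F.Reachable (v a) (v b) := by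
  unfold IsRootedForest
  rw [Finset.card_image_of_injective _ hv]
  simp [hv.eq_iff]

/-! ### Minors indexed by marked vertices -/

open Classical in
/-- The minors of the weighted Laplacian in which the rows of all marked vertices but `v i` and the
columns of all marked vertices but `v j` are removed. -/
theorem det_weightedLaplacian_submatrix_cons {V ι R : Type*} [CommRing R] [Fintype V]
    [DecidableEq V] [Fintype ι] [DecidableEq ι] {m : ℕ} (G : SimpleGraph V) (w : Sym2 V → R)
    {v : ι → V} {t : Fin m → V} (hb : Function.Bijective (Sum.elim v t)) {i j : ι}
    (hij : i ≠ j) :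
    ((weightedLaplacian G w).submatrix (Fin.cons (v i) t : Fin (m + 1) → V)
      (Fin.cons (v j) t : Fin (m + 1) → V)).det =
      -∑ F : SimpleGraph V with IsRootedForest G ((Finset.univ.erase i).image v) F ∧
        F.Reachable (v i) (v j), forestWeight w F := by
  have hv : Function.Injective v := fun a b h => Sum.inl_injective (hb.1 h)
  have ht : Function.Injective t := fun a b h => Sum.inr_injective (hb.1 h)
  have hvt : ∀ a x, v a ≠ t x := fun a x h => Sum.inl_ne_inr (hb.1 (a₁ := .inl a) (a₂ := .inr x) h)
  have hg : Function.Injective (Fin.cons (v i) (Fin.cons (v j) t : Fin (m + 1) → V) :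
      Fin (m + 2) → V) := by
    rw [Fin.cons_injective_iff, Fin.cons_injective_iff, Fin.range_cons]
    refine ⟨?_, ?_, ht⟩
    · rintro (h | ⟨x, h⟩)
      · exact hij (hv h)
      · exact hvt _ _ h.symm
    · rintro ⟨x, h⟩
      exact hvt _ _ h.symm
  have hS : ∀ s, s ∈ ((Finset.univ.erase i).erase j).image v ↔
      s ∉ Set.range (Fin.cons (v i) (Fin.cons (v j) t : Fin (m + 1) → V) : Fin (m + 2) → V) := by
    intro s
    rw [Fin.range_cons, Fin.range_cons]
    obtain ⟨a | x, rfl⟩ := hb.2 s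
    · simp [hv.eq_iff, (hvt a _).symm, and_comm]
    · simp [hvt, (hvt _ _).symm]
  have hj : v j ∉ ((Finset.univ.erase i).erase j).image v := by
    simp [hv.eq_iff]
  have hins : insert (v j) (((Finset.univ.erase i).erase j).image v)
      = (Finset.univ.erase i).image v := by
    rw [← Finset.image_insert, Finset.insert_erase (by simp [hij.symm])]
  rw [det_submatrix_cons, adjugate_weightedLaplacian_submatrix G w hg hS]
  change -((Matrix.updateRow _ (v j) (Pi.single (v i) 1)).det) = _
  rw [det_updateRow_groundedLaplacian_edgeWeight G w hj, hins]

open Classical in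
theorem det_weightedLaplacian_submatrix_cons_self {V ι R : Type*} [CommRing R] [Fintype V]
    [DecidableEq V] [Fintype ι] [DecidableEq ι] {m : ℕ} (G : SimpleGraph V) (w : Sym2 V → R)
    {v : ι → V} {t : Fin m → V} (hb : Function.Bijective (Sum.elim v t)) (j : ι) :
    ((weightedLaplacian G w).submatrix (Fin.cons (v j) t : Fin (m + 1) → V)
      (Fin.cons (v j) t : Fin (m + 1) → V)).det =
      ∑ F : SimpleGraph V with IsRootedForest G ((Finset.univ.erase j).image v) F,
        forestWeight w F := by
  have hv : Function.Injective v := fun a b h => Sum.inl_injective (hb.1 h)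
  have ht : Function.Injective t := fun a b h => Sum.inr_injective (hb.1 h)
  have hvt : ∀ a x, v a ≠ t x := fun a x h => Sum.inl_ne_inr (hb.1 (a₁ := .inl a) (a₂ := .inr x) h)
  rw [det_weightedLaplacian_submatrix G w (S := (Finset.univ.erase j).image v),
    det_groundedLaplacian_edgeWeight]
  · rw [Fin.cons_injective_iff]
    refine ⟨?_, ht⟩
    rintro ⟨x, h⟩
    exact hvt _ _ h.symm
  · intro s
    rw [Fin.range_cons]
    obtain ⟨a | x, rfl⟩ := hb.2 s
    · simp [hv.eq_iff, (hvt a _).symm]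
    · simp [hvt, (hvt _ _).symm]

open Classical in
theorem det_weightedLaplacian_submatrix_unmarked {V ι R : Type*} [CommRing R] [Fintype V]
    [DecidableEq V] [Fintype ι] {m : ℕ} (G : SimpleGraph V) (w : Sym2 V → R)
    {v : ι → V} {t : Fin m → V} (hb : Function.Bijective (Sum.elim v t)) :
    ((weightedLaplacian G w).submatrix t t).det =
      ∑ F : SimpleGraph V with IsRootedForest G (Finset.univ.image v) F, forestWeight w F := by
  have ht : Function.Injective t := fun a b h => Sum.inr_injective (hb.1 h)
  have hvt : ∀ a x, v a ≠ t x := fun a x h => Sum.inl_ne_inr (hb.1 (a₁ := .inl a) (a₂ := .inr x) h)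
  rw [det_weightedLaplacian_submatrix G w (S := Finset.univ.image v) ht,
    det_groundedLaplacian_edgeWeight]
  intro s
  obtain ⟨a | x, rfl⟩ := hb.2 s
  · simp [(hvt a _).symm]
  · simp [hvt]

/-- If `v i` and `v j` are in the same tree, either can be left out of the roots. -/
theorem isRootedForest_image_erase_iff_of_reachable {V ι : Type*} [DecidableEq V] [Fintype ι]
    [DecidableEq ι] {G : SimpleGraph V} {v : ι → V} (hv : Function.Injective v) {i j : ι}
    {F : SimpleGraph V} (hF : F.Reachable (v i) (v j)) :
    IsRootedForest G ((Finset.univ.erase i).image v) F ↔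
      IsRootedForest G ((Finset.univ.erase j).image v) F := by
  have key : ∀ {i j : ι}, F.Reachable (v i) (v j) →
      IsRootedForest G ((Finset.univ.erase i).image v) F →
      IsRootedForest G ((Finset.univ.erase j).image v) F := by
    intro i j hF h
    rw [isRootedForest_image hv] at h ⊢
    rw [Finset.card_erase_of_mem (Finset.mem_univ _)] at h ⊢
    refine ⟨h.1, fun a ha b hb hab hr => ?_⟩
    simp only [Finset.mem_erase, Finset.mem_univ, and_true] at ha hb h
    by_cases hai : a = i
    · subst hai
      exact h.2 j ha.symm b (fun h => hab h.symm) hb.symm (hF.symm.trans hr)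
    · by_cases hbi : b = i
      · subst hbi
        exact h.2 a hai j hb.symm ha (hr.trans hF)
      · exact h.2 a hai b hbi hab hr
  exact ⟨key hF, key hF.symm⟩

theorem submatrix_comp_cons {ι κ R : Type*} {m : ℕ} (A : Matrix κ κ R) (e : ι → κ) (a b : ι)
    (t : Fin m → ι) :
    (A.submatrix e e).submatrix (Fin.cons a t : Fin (m + 1) → ι) (Fin.cons b t : Fin (m + 1) → ι) =
      A.submatrix (Fin.cons (e a) (e ∘ t) : Fin (m + 1) → κ)
        (Fin.cons (e b) (e ∘ t) : Fin (m + 1) → κ) := by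
  rw [Matrix.submatrix_submatrix]
  congr 1 <;> exact funext fun x => Fin.cases rfl (fun _ => rfl) x

theorem succAbove_castLE_castAdd {k m : ℕ} (h : k + 1 ≤ k + m + 1) (c : Fin (k + 1)) (i : Fin k) :
    (Fin.castLE h c).succAbove (Fin.castAdd m i) = Fin.castLE h (c.succAbove i) := by
  ext
  simp only [Fin.succAbove, Fin.lt_def, Fin.val_castSucc, Fin.val_castAdd, Fin.val_castLE]
  split_ifs <;> simp

/-- The marked vertices and the unmarked ones are all the vertices. -/
theorem bijective_sumElim_castLE {k m : ℕ} (h : k + 1 ≤ k + m + 1) (c : Fin (k + 1)) :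
    Function.Bijective (Sum.elim (Fin.castLE h)
      ((Fin.castLE h c).succAbove ∘ Fin.natAdd k : Fin m → Fin (k + m + 1))) := by
  rw [Fintype.bijective_iff_injective_and_card]
  refine ⟨Function.Injective.sumElim (Fin.castLE_injective h)
    (Fin.succAbove_right_injective.comp (Fin.natAdd_injective m k)) fun a x hax => ?_, ?_⟩
  · have h1 := a.2
    have h2 := c.2
    -- An index that is at least `k` is not below `c`, so skipping `c` shifts it past all marked
    -- vertices.
    rw [Function.comp_apply, Fin.succAbove_of_le_castSucc _ _ ?_] at hax
    · have := congrArg Fin.val hax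
      simp at this
      omega
    · rw [Fin.le_def, Fin.val_castLE, Fin.val_castSucc, Fin.val_natAdd]
      omega
  · simp only [Fintype.card_sum, Fintype.card_fin]
    omega

theorem columnExpansionRight_eq {R : Type*} [CommRing R] {k m : ℕ} (h : k ≤ k + m)
    (M : Matrix (Fin (k + m)) (Fin (k + m)) R) (j : Fin k) :
    columnExpansionRight h M j = ∑ i : Fin k, M.adjugate (Fin.castAdd m j) (Fin.castAdd m i) *
      (M.submatrix (Fin.cons (Fin.castAdd m i) (Fin.natAdd k) : Fin (m + 1) → Fin (k + m))
        (Fin.cons (Fin.castAdd m j) (Fin.natAdd k) : Fin (m + 1) → Fin (k + m))).det := by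
  refine Finset.sum_congr rfl fun i _ => ?_
  rw [det_removeRowsCols_erase_firstIdx, adjugate_eq_det_removeRowsCols]
  rfl

/-! ### Forbidden pairs and their cancellation -/

theorem isRootedForest_pair {V : Type*} [DecidableEq V] {G F : SimpleGraph V} {a c j : V}
    (hac : a ≠ c) : IsRootedForest G (insert a {c}) F ∧ F.Reachable j a ↔
      IsSpanningForest G 2 F ∧ ¬ F.Reachable c j ∧ F.Reachable j a := by
  unfold IsRootedForest
  rw [Finset.card_pair hac]
  constructor
  · rintro ⟨⟨h1, h2⟩, h3⟩
    exact ⟨h1, fun h => h2 a (by simp) c (by simp) hac (h.trans h3).symm, h3⟩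
  · rintro ⟨h1, h2, h3⟩
    have hr : ¬ F.Reachable c a := fun h => h2 (h.trans h3.symm)
    refine ⟨⟨h1, fun s hs t ht hst => ?_⟩, h3⟩
    rw [Finset.mem_insert, Finset.mem_singleton] at hs ht
    rcases hs with rfl | rfl <;> rcases ht with rfl | rfl
    · exact absurd rfl hst
    · exact fun h => hr h.symm
    · exact hr
    · exact absurd rfl hst

/-- The pairs of a `2`-forest that separates `c` from `j` and a `k`-forest that separates the
marked vertices other than `j`, forbidden or not. -/
def separatingPairs {V : Type*} {k : ℕ} (G : SimpleGraph V) (v : Fin (k + 1) → V)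
    (c j : Fin (k + 1)) : Set (SimpleGraph V × SimpleGraph V) :=
  {p | IsSpanningForest G 2 p.1 ∧ IsSpanningForest G k p.2 ∧ ¬ p.1.Reachable (v c) (v j) ∧
    ∀ a b, a ≠ j → b ≠ j → a ≠ b → ¬ p.2.Reachable (v a) (v b)}

/-- The separating pairs in which the marked vertices `a` and `j` share their trees. -/
def sharingPairs {V : Type*} {k : ℕ} (G : SimpleGraph V) (v : Fin (k + 1) → V)
    (c j a : Fin (k + 1)) : Set (SimpleGraph V × SimpleGraph V) :=
  {p | p ∈ separatingPairs G v c j ∧ p.1.Reachable (v a) (v j) ∧ p.2.Reachable (v a) (v j)}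

/-- In a separating pair, two marked vertices in the same tree of the `k`-forest include `j`. -/
theorem isForbidden_iff_of_mem_separatingPairs {V : Type*} {k : ℕ} {G : SimpleGraph V}
    {v : Fin (k + 1) → V} {c : Fin (k + 1)} {j' : Fin k}
    {p : SimpleGraph V × SimpleGraph V} (hp : p ∈ separatingPairs G v c (c.succAbove j')) :
    IsForbidden v p.1 p.2 ↔
      ∃ i ≠ j', p ∈ sharingPairs G v c (c.succAbove j') (c.succAbove i) := by
  constructor
  · rintro ⟨a, b, hab, h1, h2⟩
    have key : ∀ a, a ≠ c.succAbove j' → p.1.Reachable (v a) (v (c.succAbove j')) →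
        p.2.Reachable (v a) (v (c.succAbove j')) →
        ∃ i ≠ j', p ∈ sharingPairs G v c (c.succAbove j') (c.succAbove i) := by
      intro a ha h1 h2
      -- The vertex `c` cannot share the tree of `j` in the 2-forest, so positions in `M` suffice as
      -- indices.
      have hac : a ≠ c := by
        rintro rfl
        exact hp.2.2.1 h1
      obtain ⟨i, rfl⟩ := Fin.exists_succAbove_eq hac
      exact ⟨i, fun h => ha (by rw [h]), hp, h1, h2⟩
    by_cases ha : a = c.succAbove j'
    · subst ha
      exact key b hab.symm h1.symm h2.symm
    · by_cases hb : b = c.succAbove j'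
      · subst hb
        exact key a hab h1 h2
      · exact absurd h2 (hp.2.2.2 a b ha hb hab)
  · rintro ⟨i, hi, -, h1, h2⟩
    exact ⟨_, _, fun h => hi (Fin.succAbove_right_injective h), h1, h2⟩

/-- The pairs that are counted with both signs on the right side cancel. -/
theorem pairSum_rightPairs {V R : Type*} [Fintype V] [CommRing R] {k : ℕ} (w : Sym2 V → R)
    (G : SimpleGraph V) (v : Fin (k + 1) → V) (c : Fin (k + 1)) (j' : Fin k) :
    pairSum w (rightPairs G v c (c.succAbove j')) +
      ∑ i ∈ Finset.univ.erase j', pairSum w (sharingPairs G v c (c.succAbove j') (c.succAbove i)) =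
        pairSum w (separatingPairs G v c (c.succAbove j')) := by
  have hright : ∀ p, p ∈ rightPairs G v c (c.succAbove j') ↔
      p ∈ separatingPairs G v c (c.succAbove j') ∧ ¬ IsForbidden v p.1 p.2 := by
    intro p
    simp only [rightPairs, separatingPairs, Set.mem_ofPred_eq]
    tauto
  rw [sum_pairSum w (Finset.univ.erase j')
    (U := {p | p ∈ separatingPairs G v c (c.succAbove j') ∧ IsForbidden v p.1 p.2})]
  · refine pairSum_add w (fun p => ?_) fun p hp hp' => ((hright p).1 hp).2 hp'.2
    rw [hright, Set.mem_ofPred_eq]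
    tauto
  · intro p
    constructor
    · rintro ⟨hp, hforb⟩
      obtain ⟨i, hi, h⟩ := (isForbidden_iff_of_mem_separatingPairs hp).1 hforb
      exact ⟨i, by simp [hi], h⟩
    · rintro ⟨i, hi, h⟩
      exact ⟨h.1, (isForbidden_iff_of_mem_separatingPairs h.1).2 ⟨i, by simpa using hi, h⟩⟩
  · intro p i hi i' hi' h h'
    by_contra hne
    have hinj := Fin.succAbove_right_injective (p := c)
    exact h.1.2.2.2 _ _ (hinj.ne (Finset.ne_of_mem_erase hi))
      (hinj.ne (Finset.ne_of_mem_erase hi')) (hinj.ne hne) (h.2.2.trans h'.2.2.symm)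

/-- The vertices of `G` are `Fin (n + 1)`, the marked ones are the first `k + 1`, and `M` is the
Laplacian with the row and the column of the marked vertex `c` removed. The index `j'` is the
position of the column of the marked vertex `j ≠ c` in `M`. -/
theorem proposition2p6 {R : Type*} [CommRing R] {n k : ℕ} (hk : k ≤ n)
    (G : SimpleGraph (Fin (n + 1))) (w : Sym2 (Fin (n + 1)) → R)
    (c j : Fin (k + 1)) (j' : Fin k) (hj : c.succAbove j' = j)
    (v : Fin (k + 1) → Fin (n + 1)) (hv : v = Fin.castLE (Nat.succ_le_succ hk))
    (M : Matrix (Fin n) (Fin n) R)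
    (hM : M = (weightedLaplacian G w).submatrix (v c).succAbove (v c).succAbove) :
    columnExpansionLeft hk M = pairSum w (leftPairs G v) ∧
    columnExpansionRight hk M j' = pairSum w (rightPairs G v c j) ∧
    columnExpansionLeft hk M = columnExpansionRight hk M j' := by
  obtain ⟨m, rfl⟩ := Nat.exists_eq_add_of_le hk
  subst hj
  have hvinj : Function.Injective v := hv ▸ Fin.castLE_injective _
  have hb : Function.Bijective
      (Sum.elim v ((v c).succAbove ∘ Fin.natAdd k : Fin m → Fin (k + m + 1))) :=
    hv ▸ bijective_sumElim_castLE _ c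
  have he : ∀ i, (v c).succAbove (Fin.castAdd m i) = v (c.succAbove i) := by
    subst hv
    exact succAbove_castLE_castAdd _ c
  have hS : ∀ s, s ∈ ({v c} : Finset (Fin (k + m + 1))) ↔ s ∉ Set.range (v c).succAbove := by
    simp [Fin.range_succAbove]
  have hinj : Function.Injective (v c).succAbove := Fin.succAbove_right_injective
  refine ⟨?_, ?_, ?_⟩
  · unfold columnExpansionLeft
    rw [det_removeRowsCols_firstIdx, hM, Matrix.submatrix_submatrix,
      det_weightedLaplacian_submatrix_unmarked G w hb, det_weightedLaplacian_submatrix G w hinj hS,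
      det_groundedLaplacian_edgeWeight, pairSum_prod]
    refine pairSum_congr w fun p => ?_
    have h1 := isRootedForest_image (G := G) hvinj (I := Finset.univ) (F := p.2)
    rw [Finset.card_univ, Fintype.card_fin] at h1
    rw [Set.mem_ofPred_eq, h1]
    simp [leftPairs, IsRootedForest]
  · have hadj : ∀ i, M.adjugate (Fin.castAdd m j') (Fin.castAdd m i) = _ := fun i => by
      rw [hM, adjugate_weightedLaplacian_submatrix G w hinj hS, he, he,
        det_updateRow_groundedLaplacian_edgeWeight G w
          (by simp [hvinj.eq_iff, Fin.succAbove_ne])]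
    have hcard : (Finset.univ.erase (c.succAbove j')).card = k := by
      simp [Finset.card_erase_of_mem]
    have hF2 : ∀ (i : Fin k) (F : SimpleGraph (Fin (k + m + 1))),
        IsRootedForest G (insert (v (c.succAbove i)) {v c}) F ∧
          F.Reachable (v (c.succAbove j')) (v (c.succAbove i)) ↔
        IsSpanningForest G 2 F ∧ ¬ F.Reachable (v c) (v (c.succAbove j')) ∧
          F.Reachable (v (c.succAbove j')) (v (c.succAbove i)) := fun i F =>
      isRootedForest_pair (hvinj.ne (Fin.succAbove_ne c i))
    have hFk : ∀ F : SimpleGraph (Fin (k + m + 1)),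
        IsRootedForest G ((Finset.univ.erase (c.succAbove j')).image v) F ↔
        IsSpanningForest G k F ∧ ∀ a b, a ≠ c.succAbove j' → b ≠ c.succAbove j' → a ≠ b →
          ¬ F.Reachable (v a) (v b) := by
      intro F
      rw [isRootedForest_image hvinj, hcard]
      simp only [Finset.mem_erase, Finset.mem_univ, and_true]
      refine and_congr_right fun _ =>
        ⟨fun h a b ha hb => h a ha b hb, fun h a ha b hb => h a b ha hb⟩
    rw [columnExpansionRight_eq, ← Finset.add_sum_erase _ _ (Finset.mem_univ j'),
      ← eq_sub_iff_add_eq.2 (pairSum_rightPairs w G v c j') |>.symm, sub_eq_add_neg,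
      ← Finset.sum_neg_distrib]
    congr 1
    · rw [hadj, hM, submatrix_comp_cons, he, det_weightedLaplacian_submatrix_cons_self G w hb,
        pairSum_prod]
      refine pairSum_congr w fun p => ?_
      rw [Set.mem_ofPred_eq, hF2, hFk]
      simp only [separatingPairs, Set.mem_ofPred_eq, SimpleGraph.Reachable.refl, and_true]
      tauto
    · refine Finset.sum_congr rfl fun i hi => ?_
      have hij : c.succAbove i ≠ c.succAbove j' :=
        Fin.succAbove_right_injective.ne (Finset.ne_of_mem_erase hi)
      rw [hadj, hM, submatrix_comp_cons, he, he, det_weightedLaplacian_submatrix_cons G w hb hij,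
        mul_neg, pairSum_prod]
      congr 1
      refine pairSum_congr w fun p => ?_
      -- The minor omits `i` from the roots; as `i` and `j` share a tree, `j` can be omitted
      -- instead.
      have hk' : IsRootedForest G ((Finset.univ.erase (c.succAbove i)).image v) p.2 ∧
          p.2.Reachable (v (c.succAbove i)) (v (c.succAbove j')) ↔ _ :=
        and_congr_left fun h => (isRootedForest_image_erase_iff_of_reachable hvinj h).trans (hFk p.2)
      rw [Set.mem_ofPred_eq, hF2, hk']
      simp only [sharingPairs, separatingPairs, Set.mem_ofPred_eq]
      rw [SimpleGraph.reachable_comm (u := v (c.succAbove j'))]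
      tauto
  · rw [columnExpansionRight_eq, sum_adjugate_mul_det_submatrix_cons]
    unfold columnExpansionLeft
    rw [det_removeRowsCols_firstIdx]
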